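/- Let $E$ be a Dedekind complete real $\Phi$-algebra, i.e. a real $f$-algebra with a multiplicative unit in which every non-empty subset that is bounded above has a supremum. (A real $f$-algebra is a real vector lattice with an associative bilinear multiplication such that products of positive elements are positive, and such that $x\wedge y=0$ and $z\ge 0$ imply $(zx)\wedge y=(xz)\wedge y=0$.) A band of $E$ is a solid linear subspace (an order ideal) that contains the supremum in $E$ of each of its subsets that has one. A weak order unit of $E$ is an element $r\ge 0$ such that the smallest band of $E$ containing $r$ is $E$ itself. For $x,y\in E$ write $x\ll y$ if $y-x$ is a weak order unit. For $a,b,c,r\in E$ with $r$ a weak order unit put $(a,b):=\{x\in E: a\ll x\ll b\}$ and $N(c,r):=\{z\in E:|z-c|\ll r\}$. A function $f\colon D\to E$ with $D\subseteq E$ is called super order differentiable at $c\in D$ with derivative $f'(c)\in E$ if there is a weak order unit $r$ with $N(c,r)\subseteq D$, and for every downwards directed set $\Delta\subseteq E$ with $\inf\Delta=0$ there is a set $\mathcal E\subseteq E$ with $\inf\mathcal E=0$ such that for every $\varepsilon\in\mathcal E$ there is a $\delta\in\Delta$ such that, for all $z\in D$, \[ |z-c|\le\delta \implies |f(z)-f(c)-(z-c)f'(c)|\le|z-c|\,\varepsilon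 . \] Let $a,b\in E$ with $a\ll b$, and let $f\colon(a,b)\to E$ be super order differentiable at every point of $(a,b)$ with $f'(c)=0$ for all $c\in(a,b)$. Then $f$ is constant on $(a,b)$. -/

import Mathlib

/-- Together with `[ConditionallyCompleteLattice E] [Ring E] [Algebra ℝ E] [IsOrderedAddMonoid E]
[IsOrderedModule ℝ E]` (a unital associative real algebra that is a Dedekind complete vector
lattice), this says that `E` is a `Φ`-algebra, that is, an `f`-algebra with a multiplicative unit.
Commutativity of the multiplication is not assumed. -/
class IsPhiAlgebra (E : Type*) [Ring E] [Lattice E] : Prop where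
  mul_nonneg : ∀ x y : E, 0 ≤ x → 0 ≤ y → 0 ≤ x * y
  mul_left_inf : ∀ x y z : E, x ⊓ y = 0 → 0 ≤ z → (z * x) ⊓ y = 0
  mul_right_inf : ∀ x y z : E, x ⊓ y = 0 → 0 ≤ z → (x * z) ⊓ y = 0

namespace PhiAlgebra

/-- A band: a linear subspace that is solid and closed under the suprema that exist in `E`. -/
structure IsBand {E : Type*} [AddCommGroup E] [Module ℝ E] [Lattice E]
    (B : Submodule ℝ E) : Prop where
  solid : ∀ x ∈ B, ∀ y : E, |y| ≤ |x| → y ∈ B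
  sup_mem : ∀ (D : Set E) (s : E), (∀ x ∈ D, x ∈ B) → IsLUB D s → s ∈ B

/-- The band generated by `x`: the smallest band that contains `x`. -/
def bandGenerated {E : Type*} [AddCommGroup E] [Module ℝ E] [Lattice E] (x : E) :
    Submodule ℝ E :=
  sInf {B : Submodule ℝ E | IsBand B ∧ x ∈ B}

/-- A weak order unit: a positive element that generates all of `E` as a band. -/
def IsWeakOrderUnit {E : Type*} [AddCommGroup E] [Module ℝ E] [Lattice E] (r : E) : Prop :=
  0 ≤ r ∧ bandGenerated r = ⊤

/-- The relation `x ≪ y`. -/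
def MuchLT {E : Type*} [AddCommGroup E] [Module ℝ E] [Lattice E] (x y : E) : Prop :=
  IsWeakOrderUnit (y - x)

/-- The order open interval `(a, b)`. -/
def openInterval {E : Type*} [AddCommGroup E] [Module ℝ E] [Lattice E] (a b : E) : Set E :=
  {x | MuchLT a x ∧ MuchLT x b}

/-- The order neighbourhood `N(c, r)`. -/
def nbhd {E : Type*} [AddCommGroup E] [Module ℝ E] [Lattice E] (c r : E) : Set E :=
  {z | MuchLT |z - c| r}

/-- `f : D → E` is super order differentiable at `c ∈ D` with derivative `f'`. Here `IsGLB A 0`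
says that `inf A = 0`, and `Δ` is moreover downwards directed. In the last condition `z` ranges
over the whole domain `D`, and not only over `N(c, r)`. -/
def HasSuperOrderDerivAt {E : Type*} [Ring E] [Algebra ℝ E] [Lattice E] {D : Set E}
    (f : D → E) (f' : E) (c : D) : Prop :=
  (∃ r : E, IsWeakOrderUnit r ∧ nbhd (c : E) r ⊆ D) ∧
  ∀ Δ : Set E, DirectedOn (fun x y => y ≤ x) Δ → IsGLB Δ 0 →
    ∃ Eps : Set E, IsGLB Eps 0 ∧ ∀ ε ∈ Eps, ∃ δ ∈ Δ, ∀ z : D, |(z : E) - c| ≤ δ →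
      |f z - f c - ((z : E) - c) * f'| ≤ |(z : E) - c| * ε

end PhiAlgebra

/-! Meets of points of the interval stay in it, since meets of weak order units are weak order
units, so comparable points x ≤ y suffice. As E is Archimedean, it is enough that |g y - g x| ≤ η •
(y - x) for every real η > 0. Let s be the supremum of the points of [x, y] up to which this slope
bound holds. The order is partial, so three facts are needed: these points are closed under joins,
because g is local (`inf_abs_sub_eq_zero`); the bound passes to s, by differentiability at s tested
on the directed set of gaps s - z (`sSup_mem_slopeSet`); and if s ≠ y, one can move beyond s in the
directions where ε is smaller than η (`right_mem_slopeSet`). -/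

namespace PhiAlgebra

/-! ### Disjointness, bands and weak order units -/

section VectorLattice

variable {E : Type*} [Lattice E] [AddCommGroup E] [IsOrderedAddMonoid E]

theorem add_inf_le {u v q : E} (hu : 0 ≤ u) (hv : 0 ≤ v) (hq : 0 ≤ q) :
    (u + v) ⊓ q ≤ u ⊓ q + v ⊓ q := by
  rw [← sub_le_iff_le_add, sub_inf]
  have h : (u + v) ⊓ q - v ≤ u := sub_le_iff_le_add.2 inf_le_left
  have h' : (u + v) ⊓ q - v ≤ q := (sub_le_self _ hv).trans inf_le_right
  have h'' : (u + v) ⊓ q - q ≤ 0 := sub_nonpos.2 inf_le_right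
  exact sup_le (le_inf h h') (h''.trans (le_inf hu hq))

theorem inf_add_eq_zero {q u v : E} (hu : 0 ≤ u) (hv : 0 ≤ v) (hqu : q ⊓ u = 0)
    (hqv : q ⊓ v = 0) : q ⊓ (u + v) = 0 := by
  have hq : 0 ≤ q := hqu ▸ inf_le_left
  refine le_antisymm ?_ (le_inf hq (add_nonneg hu hv))
  have h := add_inf_le hu hv hq
  rwa [inf_comm u, inf_comm v, hqu, hqv, add_zero, inf_comm] at h

omit [IsOrderedAddMonoid E] in
theorem inf_eq_zero_of_le {q u v : E} (hu : 0 ≤ u) (huv : u ≤ v) (hqv : q ⊓ v = 0) :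
    q ⊓ u = 0 :=
  le_antisymm ((inf_le_inf_left q huv).trans hqv.le) (le_inf (hqv ▸ inf_le_left) hu)

theorem eq_zero_of_abs_nonpos {u : E} (h : |u| ≤ 0) : u = 0 :=
  le_antisymm ((le_abs_self u).trans h) (neg_nonpos.1 ((neg_le_abs u).trans h))

theorem abs_sub_le_add (x y z : E) : |x - z| ≤ |x - y| + |y - z| := by
  simpa using abs_add_le (x - y) (y - z)

variable [Module ℝ E] [IsOrderedModule ℝ E]

theorem smul_inf_le {M : ℝ} (hM : 1 ≤ M) (u : E) {q : E} (hq : 0 ≤ q) :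
    (M • u) ⊓ q ≤ M • (u ⊓ q) := by
  have hM0 : 0 < M := by linarith
  rw [← inv_smul_le_iff_of_pos hM0]
  refine le_inf ((inv_smul_le_iff_of_pos hM0).2 inf_le_left) ?_
  refine (inv_smul_le_iff_of_pos hM0).2 (inf_le_right.trans ?_)
  simpa using smul_le_smul_of_nonneg_right hM hq

omit [IsOrderedAddMonoid E] in
theorem abs_smul_le (c : ℝ) (u : E) : |c • u| ≤ |c| • |u| := by
  refine abs_le'.2 ⟨?_, ?_⟩
  · rcases le_total 0 c with hc | hc
    · rw [abs_of_nonneg hc]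
      exact smul_le_smul_of_nonneg_left (le_abs_self u) hc
    · rw [abs_of_nonpos hc, ← neg_smul_neg]
      exact smul_le_smul_of_nonneg_left (neg_le_abs u) (neg_nonneg.2 hc)
  · rcases le_total 0 c with hc | hc
    · rw [abs_of_nonneg hc, ← smul_neg]
      exact smul_le_smul_of_nonneg_left (neg_le_abs u) hc
    · rw [abs_of_nonpos hc, ← neg_smul]
      exact smul_le_smul_of_nonneg_left (le_abs_self u) (neg_nonneg.2 hc)

omit [IsOrderedModule ℝ E] in
theorem IsBand.mem_of_nonneg_of_le {B : Submodule ℝ E} (hB : IsBand B) {x y : E} (hx : x ∈ B)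
    (hy : 0 ≤ y) (hyx : y ≤ x) : y ∈ B :=
  hB.solid x hx y (by rwa [abs_of_nonneg hy, abs_of_nonneg (hy.trans hyx)])

/-- The elements whose meet with `|q|` lies in the band `B`. -/
def infBand (B : Submodule ℝ E) (hB : IsBand B) (q : E) : Submodule ℝ E where
  carrier := {u | |u| ⊓ |q| ∈ B}
  zero_mem' := by simp
  add_mem' {u v} hu hv := by
    refine hB.mem_of_nonneg_of_le (B.add_mem hu hv) (le_inf (abs_nonneg _) (abs_nonneg _)) ?_
    exact (inf_le_inf_right _ (abs_add_le u v)).trans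
      (add_inf_le (abs_nonneg u) (abs_nonneg v) (abs_nonneg q))
  smul_mem' c u hu := by
    refine hB.mem_of_nonneg_of_le (B.smul_mem (|c| + 1) hu)
      (le_inf (abs_nonneg _) (abs_nonneg _)) ?_
    refine le_trans (inf_le_inf_right _ ?_)
      (smul_inf_le (by linarith [abs_nonneg c]) |u| (abs_nonneg q))
    exact (abs_smul_le c u).trans
      (smul_le_smul_of_nonneg_right (by linarith) (abs_nonneg u))

theorem mem_infBand {B : Submodule ℝ E} {hB : IsBand B} {q u : E} :
    u ∈ infBand B hB q ↔ |u| ⊓ |q| ∈ B := Iff.rfl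

theorem isBand_infBand (B : Submodule ℝ E) (hB : IsBand B) (q : E) :
    IsBand (infBand B hB q) where
  solid x hx y hyx :=
    hB.mem_of_nonneg_of_le hx (le_inf (abs_nonneg _) (abs_nonneg _)) (inf_le_inf_right _ hyx)
  sup_mem D s hD hs := by
    rcases D.eq_empty_or_nonempty with rfl | ⟨d, hd⟩
    -- The supremum of the empty set is a least element of `E`, hence 0.
    · have h : ∀ e : E, s ≤ e := fun e => hs.2 (by simp)
      have h0 : s = 0 := le_antisymm (h 0) (by simpa using add_le_add_left (h (s + s)) (-s))
      exact h0 ▸ zero_mem _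
    have hds : 0 ≤ s - d := sub_nonneg.2 (hs.1 hd)
    have hsd : s - d ∈ infBand B hB q := by
      rw [mem_infBand, abs_of_nonneg hds]
      -- Infinite distributivity: translating by `d` makes the supremum positive, and meets with |q|
      -- then commute with it by u ⊓ v + u ⊔ v = u + v.
      refine hB.sup_mem ((fun e => ((e - d) ⊔ 0) ⊓ |q|) '' D) _ ?_ ⟨?_, ?_⟩
      · rintro _ ⟨e, he, rfl⟩
        have h := (infBand B hB q).sub_mem (hD e he) (hD d hd)
        refine hB.mem_of_nonneg_of_le h (le_inf le_sup_right (abs_nonneg _))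
          (inf_le_inf_right _ (sup_le (le_abs_self _) (abs_nonneg _)))
      · rintro _ ⟨e, he, rfl⟩
        exact inf_le_inf_right _ (sup_le (sub_le_sub_right (hs.1 he) d) hds)
      · intro w hw
        have key : ∀ e ∈ D, e ≤ d + (w + ((s - d) ⊔ |q| - |q|)) := by
          intro e he
          have h1 : ((e - d) ⊔ 0) ⊓ |q| ≤ w := hw ⟨e, he, rfl⟩
          have h2 := inf_add_sup ((e - d) ⊔ 0) |q|
          have h3 : ((e - d) ⊔ 0) ⊔ |q| ≤ (s - d) ⊔ |q| :=
            sup_le_sup_right (sup_le (sub_le_sub_right (hs.1 he) d) hds) _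
          have h4 : e - d ≤ (e - d) ⊔ 0 := le_sup_left
          have h5 : (e - d) ⊔ 0 = ((e - d) ⊔ 0) ⊓ |q| + (((e - d) ⊔ 0) ⊔ |q| - |q|) := by
            rw [← add_sub_assoc, h2, add_sub_cancel_right]
          rw [← sub_le_iff_le_add']
          exact h4.trans (h5.le.trans (add_le_add h1 (sub_le_sub_right h3 _)))
        have h := hs.2 key
        have h2 := inf_add_sup (s - d) |q|
        have h5 : s - d = (s - d) ⊓ |q| + ((s - d) ⊔ |q| - |q|) := by
          rw [← add_sub_assoc, h2, add_sub_cancel_right]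
        exact (add_le_add_iff_right _).1 (h5.symm.le.trans (sub_le_iff_le_add'.2 h))
    simpa using (infBand B hB q).add_mem hsd (hD d hd)

omit [IsOrderedAddMonoid E] [IsOrderedModule ℝ E] in
theorem isWeakOrderUnit_iff {r : E} :
    IsWeakOrderUnit r ↔ 0 ≤ r ∧ ∀ B : Submodule ℝ E, IsBand B → r ∈ B → B = ⊤ := by
  refine and_congr_right fun _ => ⟨fun h B hB hr => ?_, fun h => ?_⟩
  · exact top_le_iff.1 (h ▸ sInf_le ⟨hB, hr⟩)
  · exact top_le_iff.1 (le_sInf fun B hB => (h B hB.1 hB.2).ge)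

omit [IsOrderedModule ℝ E] in
theorem IsWeakOrderUnit.mono {r r' : E} (hr : IsWeakOrderUnit r) (h : r ≤ r') :
    IsWeakOrderUnit r' := by
  rw [isWeakOrderUnit_iff] at hr ⊢
  exact ⟨hr.1.trans h, fun B hB hB' => hr.2 B hB (hB.mem_of_nonneg_of_le hB' hr.1 h)⟩

theorem IsWeakOrderUnit.inf {r r' : E} (hr : IsWeakOrderUnit r) (hr' : IsWeakOrderUnit r') :
    IsWeakOrderUnit (r ⊓ r') := by
  rw [isWeakOrderUnit_iff] at hr hr' ⊢
  refine ⟨le_inf hr.1 hr'.1, fun B hB h => ?_⟩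
  have h1 : infBand B hB r' = ⊤ := hr.2 _ (isBand_infBand B hB r') (by
    rwa [mem_infBand, abs_of_nonneg hr.1, abs_of_nonneg hr'.1])
  -- Membership in `infBand` is symmetric, so the roles of `r'` and `u` can be swapped.
  have h2 (u : E) : infBand B hB u = ⊤ := hr'.2 _ (isBand_infBand B hB u) (by
    rw [mem_infBand, inf_comm, ← mem_infBand (hB := hB), h1]
    trivial)
  refine eq_top_iff.2 fun u _ => ?_
  have h3 : u ∈ infBand B hB u := by rw [h2]; trivial
  rw [mem_infBand, inf_idem] at h3
  exact hB.solid _ h3 u (by rw [abs_abs])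

omit [IsOrderedModule ℝ E] in
theorem Icc_subset_openInterval {a b x y : E} (hx : x ∈ openInterval a b)
    (hy : y ∈ openInterval a b) : Set.Icc x y ⊆ openInterval a b := fun _ hz =>
  ⟨hx.1.mono (sub_le_sub_right hz.1 a), hy.2.mono (sub_le_sub_left hz.2 b)⟩

theorem inf_mem_openInterval {a b x y : E} (hx : x ∈ openInterval a b)
    (hy : y ∈ openInterval a b) : x ⊓ y ∈ openInterval a b := by
  refine ⟨?_, hx.2.mono (sub_le_sub_left inf_le_left b)⟩
  rw [MuchLT, inf_sub]
  exact hx.1.inf hy.1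

end VectorLattice

/-! ### The Archimedean property -/

section Archimedean

variable {E : Type*} [ConditionallyCompleteLattice E] [AddCommGroup E] [IsOrderedAddMonoid E]
  [Module ℝ E] [IsOrderedModule ℝ E]

/-- Dedekind completeness: the multiples of `p` are bounded by `v`, and subtracting `p` from their
supremum leaves an upper bound. -/
theorem le_zero_of_forall_le_smul {l v : E} (hv : 0 ≤ v) (h : ∀ t : ℝ, 0 < t → l ≤ t • v) :
    l ≤ 0 := by
  set p := l ⊔ 0
  have hp (t : ℝ) (ht : 0 < t) : p ≤ t • v := sup_le (h t ht) (smul_nonneg ht.le hv)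
  have hmul (n : ℕ) : ((n : ℝ) + 1) • p ≤ v := by
    have hn : (0 : ℝ) < n + 1 := by positivity
    rw [← le_inv_smul_iff_of_pos hn]
    exact hp _ (by positivity)
  let A := Set.range fun n : ℕ => ((n : ℝ) + 1) • p
  have hA : BddAbove A := ⟨v, by rintro _ ⟨n, rfl⟩; exact hmul n⟩
  have h1 : sSup A ≤ sSup A - p := by
    refine csSup_le (Set.range_nonempty _) ?_
    rintro _ ⟨n, rfl⟩
    have h2 : (((n + 1 : ℕ) : ℝ) + 1) • p ≤ sSup A := le_csSup hA ⟨n + 1, rfl⟩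
    rw [le_sub_iff_add_le]
    convert h2 using 1
    push_cast
    module
  exact le_sup_left.trans (by simpa using h1 : p ≤ 0)

theorem isGLB_smul_pos {v : E} (hv : 0 ≤ v) :
    IsGLB ((fun t : ℝ => t • v) '' Set.Ioi 0) 0 := by
  refine ⟨?_, fun l hl => le_zero_of_forall_le_smul hv fun t ht => hl ⟨t, ht, rfl⟩⟩
  rintro _ ⟨t, ht, rfl⟩
  exact smul_nonneg (le_of_lt ht) hv

theorem directedOn_smul_pos {v : E} (hv : 0 ≤ v) :
    DirectedOn (fun x y => y ≤ x) ((fun t : ℝ => t • v) '' Set.Ioi 0) := by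
  rintro _ ⟨t, ht, rfl⟩ _ ⟨t', ht', rfl⟩
  exact ⟨_, ⟨min t t', lt_min (Set.mem_Ioi.1 ht) (Set.mem_Ioi.1 ht'), rfl⟩,
    smul_le_smul_of_nonneg_right (min_le_left _ _) hv,
    smul_le_smul_of_nonneg_right (min_le_right _ _) hv⟩

end Archimedean

/-! ### Multiplication in a Φ-algebra -/

section Algebra

variable {E : Type*} [Lattice E] [Ring E] [IsPhiAlgebra E]

theorem mul_eq_zero_of_inf_eq_zero {x y : E} (h : x ⊓ y = 0) : x * y = 0 := by
  have hx : 0 ≤ x := h ▸ inf_le_left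
  have hy : 0 ≤ y := h ▸ inf_le_right
  have h1 := IsPhiAlgebra.mul_right_inf x y y h hy
  have h2 := IsPhiAlgebra.mul_left_inf y (x * y) x (by rwa [inf_comm]) hx
  rwa [inf_idem] at h2

variable [IsOrderedAddMonoid E]

theorem mul_le_mul_of_nonneg_left' {x y z : E} (h : x ≤ y) (hz : 0 ≤ z) : z * x ≤ z * y := by
  rw [← sub_nonneg, ← mul_sub]
  exact IsPhiAlgebra.mul_nonneg _ _ hz (sub_nonneg.2 h)

theorem mul_le_mul_of_nonneg_right' {x y z : E} (h : x ≤ y) (hz : 0 ≤ z) : x * z ≤ y * z := by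
  rw [← sub_nonneg, ← sub_mul]
  exact IsPhiAlgebra.mul_nonneg _ _ (sub_nonneg.2 h) hz

theorem sq_nonneg' (x : E) : 0 ≤ x * x := by
  have h1 : x⁺ * x⁻ = 0 := mul_eq_zero_of_inf_eq_zero (posPart_inf_negPart_eq_zero x)
  have h2 : x⁻ * x⁺ = 0 :=
    mul_eq_zero_of_inf_eq_zero (by rw [inf_comm, posPart_inf_negPart_eq_zero])
  have h3 : x * x = x⁺ * x⁺ + x⁻ * x⁻ := by
    conv_lhs => rw [← posPart_sub_negPart x]
    rw [sub_mul, mul_sub, mul_sub, h1, h2]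
    abel
  rw [h3]
  exact add_nonneg (IsPhiAlgebra.mul_nonneg _ _ (posPart_nonneg x) (posPart_nonneg x))
    (IsPhiAlgebra.mul_nonneg _ _ (negPart_nonneg x) (negPart_nonneg x))

theorem one_nonneg' : (0 : E) ≤ 1 := by simpa using sq_nonneg' (1 : E)

theorem mul_nonneg_of_le_posPart {u x : E} (hu : 0 ≤ u) (hux : u ≤ x⁺) : 0 ≤ u * x := by
  have h : u * x⁻ = 0 := mul_eq_zero_of_inf_eq_zero (by
    rw [inf_comm]
    exact inf_eq_zero_of_le hu hux (by rw [inf_comm, posPart_inf_negPart_eq_zero]))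
  rw [← posPart_sub_negPart x, mul_sub, h, sub_zero]
  exact IsPhiAlgebra.mul_nonneg _ _ hu (posPart_nonneg x)

variable [Algebra ℝ E] [IsOrderedModule ℝ E]

omit [IsOrderedAddMonoid E] [IsOrderedModule ℝ E] in
theorem eq_zero_of_inf_smul_one_eq_zero {v : E} {η : ℝ} (hη : 0 < η)
    (h : v ⊓ η • (1 : E) = 0) : v = 0 := by
  have hv : 0 ≤ v := h ▸ inf_le_left
  have h1 := mul_eq_zero_of_inf_eq_zero h
  rw [mul_smul_comm, mul_one] at h1
  exact (smul_eq_zero.1 h1).resolve_left hη.ne'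

/-- Expand s⁻¹(s - ε)² ≥ 0 and drop one of the two copies of ε. This splits a possibly unbounded ε
into a scalar part and a square with a coefficient of choice. -/
theorem le_smul_one_add_smul_sq {ε : E} (hε : 0 ≤ ε) {s : ℝ} (hs : 0 < s) :
    ε ≤ s • (1 : E) + s⁻¹ • (ε * ε) := by
  have h := smul_nonneg (inv_nonneg.2 hs.le) (sq_nonneg' (s • (1 : E) - ε))
  have h1 : s⁻¹ • ((s • (1 : E) - ε) * (s • (1 : E) - ε)) =
      s • (1 : E) + s⁻¹ • (ε * ε) - ε - ε := by
    simp only [sub_mul, mul_sub, smul_mul_assoc, mul_smul_comm, one_mul, mul_one, smul_sub,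
      smul_smul, inv_mul_cancel₀ hs.ne', one_smul, ← mul_assoc]
    abel
  rw [h1, sub_nonneg] at h
  exact sub_nonneg.1 (hε.trans h)

end Algebra

/-! ### Functions with zero derivative on an order interval -/

section Derivative

variable {E : Type*} [ConditionallyCompleteLattice E] [Ring E] [Algebra ℝ E]
  [IsOrderedAddMonoid E] [IsOrderedModule ℝ E] [IsPhiAlgebra E]

/-- Multiplication by a positive element preserves vanishing infima of downwards directed sets. -/
theorem le_zero_of_forall_le_mul {V : Set E} (hdir : DirectedOn (fun x y => y ≤ x) V)
    (hne : V.Nonempty) (hV : IsGLB V 0) {ε l : E} (hε : 0 ≤ ε) (h : ∀ v ∈ V, l ≤ v * ε) :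
    l ≤ 0 := by
  obtain ⟨v₀, hv₀⟩ := hne
  have hsq := IsPhiAlgebra.mul_nonneg _ _ (hV.1 hv₀) (sq_nonneg' ε)
  refine le_zero_of_forall_le_smul hsq fun t ht => ?_
  rw [← sub_nonpos]
  have key : t • (l - t • (v₀ * (ε * ε))) ≤ 0 := by
    refine hV.2 fun v hv => ?_
    -- Below both `v` and `v₀`: the scalar term keeps `v`, whose infimum is 0, and the square term
    -- is bounded by the fixed `v₀`.
    obtain ⟨w, hw, hwv, hwv₀⟩ := hdir v hv v₀ hv₀
    rw [← le_inv_smul_iff_of_pos ht, sub_le_iff_le_add]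
    calc l ≤ w * ε := h w hw
      _ ≤ w * (t⁻¹ • (1 : E) + t⁻¹⁻¹ • (ε * ε)) :=
        mul_le_mul_of_nonneg_left' (le_smul_one_add_smul_sq hε (inv_pos.2 ht)) (hV.1 hw)
      _ = t⁻¹ • w + t • (w * (ε * ε)) := by
        rw [inv_inv, mul_add, mul_smul_comm, mul_smul_comm, mul_one]
      _ ≤ t⁻¹ • v + t • (v₀ * (ε * ε)) :=
        add_le_add (smul_le_smul_of_nonneg_left hwv (inv_nonneg.2 ht.le))
          (smul_le_smul_of_nonneg_left (mul_le_mul_of_nonneg_right' hwv₀ (sq_nonneg' ε)) ht.le)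
  have := smul_nonpos_of_nonneg_of_nonpos (inv_nonneg.2 ht.le) key
  rwa [inv_smul_smul₀ ht.ne'] at this

/-- `g` has super order derivative `0` at `c` relative to the set `s`. -/
def HasZeroDerivWithinAt (g : E → E) (s : Set E) (c : E) : Prop :=
  ∀ Δ : Set E, DirectedOn (fun x y => y ≤ x) Δ → IsGLB Δ 0 →
    ∃ Eps : Set E, IsGLB Eps 0 ∧ ∀ ε ∈ Eps, ∃ δ ∈ Δ, ∀ z ∈ s, |z - c| ≤ δ →
      |g z - g c| ≤ |z - c| * ε

omit [Algebra ℝ E] [IsOrderedAddMonoid E] [IsOrderedModule ℝ E] [IsPhiAlgebra E] in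
theorem HasZeroDerivWithinAt.mono {g : E → E} {s t : Set E} {c : E}
    (h : HasZeroDerivWithinAt g s c) (hts : t ⊆ s) : HasZeroDerivWithinAt g t c := by
  intro Δ hdir hΔ
  obtain ⟨Eps, hEps, H⟩ := h Δ hdir hΔ
  refine ⟨Eps, hEps, fun ε hε => ?_⟩
  obtain ⟨δ, hδ, H'⟩ := H ε hε
  exact ⟨δ, hδ, fun z hz => H' z (hts hz)⟩

omit [Algebra ℝ E] [IsOrderedModule ℝ E] [IsPhiAlgebra E] in
-- An empty set with infimum 0 would make 0 the greatest element.
theorem nonempty_of_isGLB [Nontrivial E] {A : Set E} (hA : IsGLB A 0) : A.Nonempty := by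
  by_contra hne
  rw [Set.not_nonempty_iff_eq_empty] at hne
  subst hne
  obtain ⟨x, hx⟩ := exists_ne (0 : E)
  have h (e : E) : e ≤ 0 := hA.2 (by simp)
  exact hx (le_antisymm (h x) (by simpa using h (-x)))

variable [Nontrivial E] {g : E → E} {x y : E}

/-- A function with vanishing derivative is local: where its argument does not change, neither does
its value. -/
theorem inf_abs_sub_eq_zero (hxy : x ≤ y)
    (hg : ∀ c ∈ Set.Icc x y, HasZeroDerivWithinAt g (Set.Icc x y) c) {q : E}
    (hq : q ⊓ (y - x) = 0) : q ⊓ |g y - g x| = 0 := by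
  set w := y - x with hw_def
  have hw : 0 ≤ w := sub_nonneg.2 hxy
  have hmem (t : ℝ) (ht : t ∈ Set.Icc (0 : ℝ) 1) : x + t • w ∈ Set.Icc x y := by
    refine ⟨le_add_of_nonneg_right (smul_nonneg ht.1 hw), ?_⟩
    have h1 : t • w ≤ (1 : ℝ) • w := smul_le_smul_of_nonneg_right ht.2 hw
    rw [one_smul] at h1
    exact (add_le_add_right h1 x).trans_eq (by rw [hw_def]; abel)
  -- Along the segment from x to y, nearby increments of g are at most w * ε, which is disjoint from
  -- `q`; connectedness of [0, 1] chains them.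
  have key := (isPreconnected_Icc (a := (0 : ℝ)) (b := 1)).induction₂
    (fun t t' => q ⊓ |g (x + t' • w) - g (x + t • w)| = 0) ?_ ?_ ?_
    (Set.left_mem_Icc.2 zero_le_one) (Set.right_mem_Icc.2 zero_le_one)
  · simpa [hw_def] using key
  · intro t ht
    obtain ⟨Eps, hEps, H⟩ := hg _ (hmem t ht) _ (directedOn_smul_pos hw) (isGLB_smul_pos hw)
    obtain ⟨ε, hε⟩ := nonempty_of_isGLB hEps
    obtain ⟨_, ⟨r, hr, rfl⟩, H'⟩ := H ε hε
    filter_upwards [self_mem_nhdsWithin, mem_nhdsWithin_of_mem_nhds (Metric.ball_mem_nhds t hr)]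
      with t' ht' hball
    have hsub : x + t' • w - (x + t • w) = (t' - t) • w := by module
    have hle : |x + t' • w - (x + t • w)| ≤ |t' - t| • w := by
      rw [hsub]
      simpa only [abs_of_nonneg hw] using abs_smul_le (t' - t) w
    rw [Metric.mem_ball, Real.dist_eq] at hball
    have h1 := H' _ (hmem t' ht') (hle.trans (smul_le_smul_of_nonneg_right hball.le hw))
    have hdisj : q ⊓ (w * ε) = 0 := by
      rw [inf_comm]
      exact IsPhiAlgebra.mul_right_inf w q ε (by rwa [inf_comm]) (hEps.1 hε)
    refine inf_eq_zero_of_le (abs_nonneg _) (h1.trans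
      (mul_le_mul_of_nonneg_right' (hle.trans ?_) (hEps.1 hε))) hdisj
    have h2 : |t' - t| ≤ 1 := abs_le.2 ⟨by linarith [ht.2, ht'.1], by linarith [ht.1, ht'.2]⟩
    simpa using smul_le_smul_of_nonneg_right h2 hw
  · intro t t' t'' _ _ _ h1 h2
    exact inf_eq_zero_of_le (abs_nonneg _) (abs_sub_le_add _ _ _)
      (inf_add_eq_zero (abs_nonneg _) (abs_nonneg _) h2 h1)
  · intro t t' _ _ h
    rwa [abs_sub_comm]

theorem inf_abs_sub_eq_zero_of_mem
    (hg : ∀ c ∈ Set.Icc x y, HasZeroDerivWithinAt g (Set.Icc x y) c) {z z' q : E}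
    (hz : x ≤ z) (hzz' : z ≤ z') (hz' : z' ≤ y) (hq : q ⊓ (z' - z) = 0) :
    q ⊓ |g z' - g z| = 0 :=
  inf_abs_sub_eq_zero hzz'
    (fun c hc => (hg c (Set.Icc_subset_Icc hz hz' hc)).mono (Set.Icc_subset_Icc hz hz')) hq

/-- The points of `[x, y]` up to which `g` has grown at most with slope `η`. -/
def slopeSet (g : E → E) (x y : E) (η : ℝ) : Set E :=
  {z ∈ Set.Icc x y | |g z - g x| ≤ η • (z - x)}

variable {η : ℝ}

theorem sup_mem_slopeSet (hη : 0 ≤ η)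
    (hg : ∀ c ∈ Set.Icc x y, HasZeroDerivWithinAt g (Set.Icc x y) c) {z z' : E}
    (hz : z ∈ slopeSet g x y η) (hz' : z' ∈ slopeSet g x y η) : z ⊔ z' ∈ slopeSet g x y η := by
  have hsup : z ⊔ z' ≤ y := sup_le hz.1.2 hz'.1.2
  refine ⟨⟨hz.1.1.trans le_sup_left, hsup⟩, ?_⟩
  have h0 : (z ⊔ z' - z) ⊓ (z ⊔ z' - z') = 0 := by
    rw [← sub_sup, sub_self]
  have h1 := inf_abs_sub_eq_zero_of_mem hg hz.1.1 le_sup_left hsup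
    (by rwa [inf_comm] : (z ⊔ z' - z') ⊓ (z ⊔ z' - z) = 0)
  have h2 := inf_abs_sub_eq_zero_of_mem hg hz'.1.1 le_sup_right hsup
    (by rwa [inf_comm] : |g (z ⊔ z') - g z| ⊓ (z ⊔ z' - z') = 0)
  -- The excess over the slope bound lies below both increments of g, which are disjoint by `h2`.
  have hle {e : E} (he : e ∈ slopeSet g x y η) (hle : e ≤ z ⊔ z') :
      |g (z ⊔ z') - g x| - η • (z ⊔ z' - x) ≤ |g (z ⊔ z') - g e| := by
    rw [sub_le_iff_le_add]
    exact (abs_sub_le_add _ (g e) _).trans (add_le_add_right (he.2.trans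
      (smul_le_smul_of_nonneg_left (sub_le_sub_right hle x) hη)) _)
  exact sub_nonpos.1 ((le_inf (hle hz le_sup_left) (hle hz' le_sup_right)).trans h2.le)

theorem sSup_mem_slopeSet (hxy : x ≤ y) (hη : 0 ≤ η)
    (hg : ∀ c ∈ Set.Icc x y, HasZeroDerivWithinAt g (Set.Icc x y) c) :
    sSup (slopeSet g x y η) ∈ slopeSet g x y η := by
  set S := slopeSet g x y η with hS
  have hxS : x ∈ S := ⟨⟨le_rfl, hxy⟩, by simp⟩
  have hbdd : BddAbove S := ⟨y, fun z hz => hz.1.2⟩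
  set s := sSup S
  have hlub : IsLUB S s := isLUB_csSup ⟨x, hxS⟩ hbdd
  have hs : s ∈ Set.Icc x y := ⟨hlub.1 hxS, hlub.2 fun z hz => hz.1.2⟩
  refine ⟨hs, ?_⟩
  have hdir : DirectedOn (fun u v => v ≤ u) ((fun z => s - z) '' S) := by
    rintro _ ⟨z, hz, rfl⟩ _ ⟨z', hz', rfl⟩
    exact ⟨_, ⟨_, sup_mem_slopeSet hη hg hz hz', rfl⟩, sub_le_sub_left le_sup_left s,
      sub_le_sub_left le_sup_right s⟩
  have hglb : IsGLB ((fun z => s - z) '' S) 0 := by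
    refine ⟨?_, fun l hl => ?_⟩
    · rintro _ ⟨z, hz, rfl⟩
      exact sub_nonneg.2 (hlub.1 hz)
    · have h : s ≤ s - l := hlub.2 fun z hz => le_sub_comm.1 (hl ⟨z, hz, rfl⟩)
      simpa using h
  obtain ⟨Eps, hEps, H⟩ := hg s hs _ hdir hglb
  obtain ⟨ε, hε⟩ := nonempty_of_isGLB hEps
  obtain ⟨_, ⟨z₀, hz₀, rfl⟩, H'⟩ := H ε hε
  rw [← sub_nonpos]
  refine le_zero_of_forall_le_mul hdir ⟨_, _, hxS, rfl⟩ hglb (hEps.1 hε) ?_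
  rintro _ ⟨z, hz, rfl⟩
  -- Joining with `z₀` brings the point within δ = s - z₀ of s.
  have hz₁ : z ⊔ z₀ ∈ S := sup_mem_slopeSet hη hg hz hz₀
  have habs : |z ⊔ z₀ - s| = s - z ⊔ z₀ := by
    rw [abs_sub_comm, abs_of_nonneg (sub_nonneg.2 (hlub.1 hz₁))]
  have h1 := H' _ hz₁.1 (habs.le.trans (sub_le_sub_left le_sup_right s))
  rw [habs, abs_sub_comm] at h1
  rw [sub_le_iff_le_add]
  refine (abs_sub_le_add _ (g (z ⊔ z₀)) _).trans (add_le_add (h1.trans ?_) (hz₁.2.trans ?_))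
  · exact mul_le_mul_of_nonneg_right' (sub_le_sub_left le_sup_left s) (hEps.1 hε)
  · exact smul_le_smul_of_nonneg_left (sub_le_sub_right (hlub.1 hz₁) x) hη

omit [Nontrivial E] in
-- Otherwise v ⊓ η • 1 lies below every ε, hence vanishes, although the unit is disjoint only from
-- 0.
theorem exists_inf_posPart_ne_zero {Eps : Set E} (hEps : IsGLB Eps 0) {v : E} (hv : 0 ≤ v)
    (hv0 : v ≠ 0) (hη : 0 < η) : ∃ ε ∈ Eps, (η • (1 : E) - ε)⁺ ⊓ v ≠ 0 := by
  by_contra! hcon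
  refine hv0 (eq_zero_of_inf_smul_one_eq_zero hη
    (le_antisymm (hEps.2 fun ε hε => ?_) (le_inf hv (smul_nonneg hη.le one_nonneg'))))
  rw [← sub_nonpos]
  refine (le_inf ?_ ?_).trans (hcon ε hε).le
  · exact (sub_le_sub_right inf_le_right ε).trans (le_posPart _)
  · exact (sub_le_self _ (hEps.1 hε)).trans inf_le_left

theorem right_mem_slopeSet (hxy : x ≤ y) (hη : 0 < η)
    (hg : ∀ c ∈ Set.Icc x y, HasZeroDerivWithinAt g (Set.Icc x y) c) :
    y ∈ slopeSet g x y η := by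
  have hs := sSup_mem_slopeSet hxy hη.le hg
  have hmax {z : E} (hz : z ∈ slopeSet g x y η) : z ≤ sSup (slopeSet g x y η) :=
    le_csSup ⟨y, fun z hz => hz.1.2⟩ hz
  set s := sSup (slopeSet g x y η)
  by_contra hy
  have hv : 0 ≤ y - s := sub_nonneg.2 hs.1.2
  have hv0 : y - s ≠ 0 := fun h => hy ((sub_eq_zero.1 h).symm ▸ hs)
  obtain ⟨Eps, hEps, H⟩ := hg s hs.1 _ (directedOn_smul_pos hv) (isGLB_smul_pos hv)
  obtain ⟨ε, hε, hne⟩ := exists_inf_posPart_ne_zero hEps hv hv0 hη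
  obtain ⟨_, ⟨t, ht, rfl⟩, H'⟩ := H ε hε
  set p := (η • (1 : E) - ε)⁺ ⊓ (y - s)
  have hp : 0 ≤ p := le_inf (posPart_nonneg _) hv
  -- The bound t keeps the step within δ; the bound 1 keeps it below y - s and (η • 1 - ε)⁺.
  set r := min t 1
  have hr : 0 < r := lt_min ht one_pos
  have hrp : 0 ≤ r • p := smul_nonneg hr.le hp
  have hsr : s ≤ s + r • p := le_add_of_nonneg_right hrp
  have hr1 : r • p ≤ p := by
    simpa using smul_le_smul_of_nonneg_right (min_le_right t 1) hp
  have hmem : s + r • p ∈ Set.Icc x y := by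
    refine ⟨hs.1.1.trans hsr, ?_⟩
    rw [← le_sub_iff_add_le']
    exact hr1.trans inf_le_right
  have habs : |s + r • p - s| = r • p := by rw [add_sub_cancel_left, abs_of_nonneg hrp]
  have h1 := H' _ hmem (habs.le.trans ((smul_le_smul_of_nonneg_right (min_le_left t 1) hp).trans
    (smul_le_smul_of_nonneg_left inf_le_right (le_of_lt ht))))
  have h2 : r • p * ε ≤ η • (r • p) := by
    have h := mul_nonneg_of_le_posPart hrp (hr1.trans inf_le_left)
    rwa [mul_sub, mul_smul_comm, mul_one, sub_nonneg] at h
  rw [habs] at h1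
  have hmem' : s + r • p ∈ slopeSet g x y η := by
    refine ⟨hmem, (abs_sub_le_add _ (g s) _).trans ((add_le_add (h1.trans h2) hs.2).trans_eq ?_)⟩
    module
  have h3 : r • p ≤ 0 := by simpa using hmax hmem'
  exact hne ((smul_eq_zero.1 (le_antisymm h3 hrp)).resolve_left hr.ne')

theorem eq_of_hasZeroDerivWithinAt (hxy : x ≤ y)
    (hg : ∀ c ∈ Set.Icc x y, HasZeroDerivWithinAt g (Set.Icc x y) c) : g y = g x := by
  have h : |g y - g x| ≤ 0 := le_zero_of_forall_le_smul (sub_nonneg.2 hxy)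
    fun η hη => (right_mem_slopeSet hxy hη hg).2
  exact sub_eq_zero.1 (eq_zero_of_abs_nonpos h)

end Derivative

/-! ### Passage to the open interval -/

theorem HasSuperOrderDerivAt.hasZeroDerivWithinAt {E : Type*} [ConditionallyCompleteLattice E]
    [Ring E] [Algebra ℝ E] {D : Set E} {f : D → E} {g : E → E} (hfg : ∀ z : D, g z = f z) {c : D}
    (h : HasSuperOrderDerivAt f 0 c) : HasZeroDerivWithinAt g D c := by
  intro Δ hdir hΔ
  obtain ⟨Eps, hEps, H⟩ := h.2 Δ hdir hΔ
  refine ⟨Eps, hEps, fun ε hε => ?_⟩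
  obtain ⟨δ, hδ, H'⟩ := H ε hε
  refine ⟨δ, hδ, fun z hz hzc => ?_⟩
  simpa [← hfg] using H' ⟨z, hz⟩ hzc

end PhiAlgebra

theorem mainTheorem9 {E : Type*} [ConditionallyCompleteLattice E] [Ring E] [Algebra ℝ E]
    [IsOrderedAddMonoid E] [IsOrderedModule ℝ E] [IsPhiAlgebra E]
    (a b : E) (hab : PhiAlgebra.MuchLT a b)
    (f : PhiAlgebra.openInterval a b → E)
    (hf : ∀ c : PhiAlgebra.openInterval a b, PhiAlgebra.HasSuperOrderDerivAt f 0 c) :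
    ∃ k : E, ∀ x : PhiAlgebra.openInterval a b, f x = k := by
  classical
  rcases subsingleton_or_nontrivial E with hE | hE
  · exact ⟨0, fun x => Subsingleton.elim _ _⟩
  rcases isEmpty_or_nonempty (PhiAlgebra.openInterval a b) with hD | ⟨⟨x₀⟩⟩
  · exact ⟨0, fun x => hD.elim x⟩
  let g : E → E := fun z => if h : z ∈ PhiAlgebra.openInterval a b then f ⟨z, h⟩ else 0
  have hfg (z : PhiAlgebra.openInterval a b) : g z = f z := by simp [g]
  have hmono (x y : PhiAlgebra.openInterval a b) (hxy : (x : E) ≤ y) : f y = f x := by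
    rw [← hfg, ← hfg]
    have hsub := PhiAlgebra.Icc_subset_openInterval x.2 y.2
    exact PhiAlgebra.eq_of_hasZeroDerivWithinAt hxy fun c hc =>
      ((hf ⟨c, hsub hc⟩).hasZeroDerivWithinAt hfg).mono hsub
  refine ⟨f x₀, fun x => ?_⟩
  let m : PhiAlgebra.openInterval a b :=
    ⟨(x : E) ⊓ x₀, PhiAlgebra.inf_mem_openInterval x.2 x₀.2⟩
  exact (hmono m x inf_le_left).trans (hmono m x₀ inf_le_right).symm
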